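/- A partially ordered set $(T,<)$ is a \emph{pseudotree} if $\{w\in T: w<x\}$ is totally ordered for every $x\in T$; it is \emph{special} if it is a countable union of antichains (sets of pairwise incomparable elements). An \emph{interval} of $T$ is a totally ordered subset $I\subseteq T$ such that $s\in I$ whenever $r,t\in I$ and $r<s<t$. A family $\mathscr{F}$ of subsets of a topological space is \emph{isolated} if $E\cap\overline{\bigcup(\mathscr{F}\setminus\{E\})}=\varnothing$ for all $E\in\mathscr{F}$; a family $\mathscr{N}$ is a \emph{network} if for every open $U$ and $x\in U$ there is $N\in\mathscr{N}$ with $x\in N\subseteq U$. A regular Hausdorff space is \emph{descriptive} if it is compact and has a network that is a countable union of isolated families. Let $A$ be a set and let $(T_a,<_a)_{a\in A}$ be a family of special pseudotrees, whose underlying sets may overlap, such that whenever $a,b\in A$ are distinct, $I$ is an interval of $T_a$ and $J$ is an interval of $T_b$, the intersection $I\cap J$ has at most one element. Let $T=\bigcup_{a\in A}T_a$ and $$\Omega=\{\mathbf 1_I\in\{0,1\}^T : I \text{ is an interval of } T_a \text{ for some } a\in A\},$$ with the topology of pointwise convergence. Then $\Omega$ is compact and descriptive. -/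

import Mathlib

open Set

/-- A family `N` of subsets of `Z` is a network if every point of every open set `U` lies in
a member of `N` that is contained in `U`. -/
def IsNetwork {Z : Type*} [TopologicalSpace Z] (N : Set (Set Z)) : Prop :=
  ∀ (x : Z) (U : Set Z), IsOpen U → x ∈ U → ∃ E ∈ N, x ∈ E ∧ E ⊆ U

/-- A family of sets is isolated if no member meets the closure of the union of the others. -/
def IsIsolatedFamily {Z : Type*} [TopologicalSpace Z] (F : Set (Set Z)) : Prop :=
  ∀ E ∈ F, E ∩ closure (⋃₀ (F \ {E})) = ∅

/-- A descriptive (compact) space: a regular Hausdorff space that is compact and has a network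
which is a countable union of isolated families. -/
structure IsDescriptive (Z : Type*) [TopologicalSpace Z] : Prop where
  regular : T3Space Z
  compact : CompactSpace Z
  exists_network : ∃ N : ℕ → Set (Set Z),
    (∀ n, IsIsolatedFamily (N n)) ∧ IsNetwork (⋃ n, N n)

/-- A pseudotree: the strict predecessors of every element are totally ordered. -/
def IsPseudotree (T : Type*) [PartialOrder T] : Prop :=
  ∀ x : T, IsChain (· ≤ ·) (Iio x)

/-- A partially ordered set is special if it is a countable union of antichains. -/
def IsSpecialOrder (T : Type*) [PartialOrder T] : Prop :=
  ∃ Γ : ℕ → Set T, (∀ n, IsAntichain (· ≤ ·) (Γ n)) ∧ ⋃ n, Γ n = univ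

/-- An interval of a pseudotree: a totally ordered, order-convex subset. -/
def IsTreeInterval {T : Type*} [PartialOrder T] (I : Set T) : Prop :=
  IsChain (· ≤ ·) I ∧ ∀ r ∈ I, ∀ t ∈ I, ∀ s : T, r < s → s < t → s ∈ I

/-- The set of indicator functions, on the union of the (possibly overlapping) sets `T a`, of
the intervals of the individual `T a`. The ambient space `ℝ^(⋃ a, T a)` carries the topology
of pointwise convergence (the product topology). -/
def intervalIndicators {X A : Type*} (T : A → Set X) [∀ a, PartialOrder (T a)] :
    Set ((⋃ a, T a : Set X) → ℝ) :=
  {f | ∃ (a : A) (I : Set (T a)), IsTreeInterval I ∧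
    f = indicator {x : (⋃ a, T a : Set X) | (x : X) ∈ (Subtype.val '' I : Set X)} 1}

/-! Two points of an interval determine its tree, so a pointwise limit whose support has two points
is approximated by intervals of a single `T a`. Being an interval is tested on at most three points
at a time, so it passes to the limit; supports with at most one point are trivially intervals. Hence
the space is closed in a product of copies of `{0, 1}` (`isClosed_intervalIndicators`).

For the network, specialness gives levels in `ℕ` that are injective on chains, so an interval has
finitely many points at levels in a finite set `H`. Cells prescribe those points. Once `H` and the
set `F` of occupied levels are fixed, demanding value `1` at the prescribed points is an open
condition that singles out one cell (`isIsolatedFamily_levelCellFamily`). There are countably many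
pairs `(F, H)`; supports with at most one point are treated separately. -/

/-- A family of sets is isolated if every member has an open superset meeting no other member. -/
theorem isIsolatedFamily_of_open_expansion {Z : Type*} [TopologicalSpace Z] {F : Set (Set Z)}
    (h : ∀ E ∈ F, ∃ U, IsOpen U ∧ E ⊆ U ∧ ∀ E' ∈ F, (E' ∩ U).Nonempty → E' = E) :
    IsIsolatedFamily F := by
  intro E hE
  obtain ⟨U, hU, hEU, hsep⟩ := h E hE
  rw [Set.eq_empty_iff_forall_notMem]
  rintro z ⟨hzE, hz⟩
  obtain ⟨w, hwU, E', ⟨hE', hne⟩, hwE'⟩ := mem_closure_iff.1 hz U hU (hEU hzE)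
  exact hne (hsep E' hE' ⟨w, hwE', hwU⟩)

/-- A network indexed by a countable type of isolated families can be reindexed by `ℕ`. -/
theorem exists_nat_network_of_countable {Z ι : Type*} [TopologicalSpace Z] [Countable ι]
    (N : ι → Set (Set Z)) (hN : ∀ i, IsIsolatedFamily (N i)) (hnet : IsNetwork (⋃ i, N i)) :
    ∃ N' : ℕ → Set (Set Z), (∀ n, IsIsolatedFamily (N' n)) ∧ IsNetwork (⋃ n, N' n) := by
  obtain ⟨e, he⟩ := exists_injective_nat ι
  refine ⟨fun n => {E | ∃ i, e i = n ∧ E ∈ N i}, fun n => ?_, fun x U hU hx => ?_⟩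
  · rintro E ⟨i, rfl, hE⟩
    have : {E | ∃ j, e j = e i ∧ E ∈ N j} = N i := by
      ext E'
      constructor
      · rintro ⟨j, hj, hE'⟩
        rwa [← he hj]
      · exact fun hE' => ⟨i, rfl, hE'⟩
    beta_reduce
    rw [this]
    exact hN i E hE
  · obtain ⟨E, hE, hxE, hEU⟩ := hnet x U hU hx
    obtain ⟨i, hi⟩ := mem_iUnion.1 hE
    exact ⟨E, mem_iUnion.2 ⟨e i, i, rfl, hi⟩, hxE, hEU⟩

/-- A special order carries a level function to `ℕ` that is injective on chains. -/
theorem IsSpecialOrder.exists_level {T : Type*} [PartialOrder T] (h : IsSpecialOrder T) :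
    ∃ lev : T → ℕ, ∀ C : Set T, IsChain (· ≤ ·) C → InjOn lev C := by
  obtain ⟨Γ, hΓ, hU⟩ := h
  have hx : ∀ x, ∃ n, x ∈ Γ n := fun x => mem_iUnion.1 (hU ▸ mem_univ x)
  choose lev hlev using hx
  refine ⟨lev, fun C hC x hx y hy hxy => ?_⟩
  by_contra hne
  have hy' : y ∈ Γ (lev x) := hxy ▸ hlev y
  rcases hC hx hy hne with hle | hle
  · exact hΓ _ (hlev x) hy' hne hle
  · exact hΓ _ hy' (hlev x) (Ne.symm hne) hle

theorem isTreeInterval_of_subsingleton {T : Type*} [PartialOrder T] {I : Set T}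
    (h : I.Subsingleton) : IsTreeInterval I := by
  refine ⟨h.isChain, fun r hr t ht s hrs hst => ?_⟩
  exact absurd (hrs.trans hst) (by rw [h hr ht]; exact lt_irrefl t)

/-! ### Indicators on the union -/

section Union

variable {X A : Type*} (T : A → Set X)

/-- The inclusion of a member of a family of sets into the union of the family. -/
def unionIncl (a : A) (x : T a) : (⋃ a, T a : Set X) := ⟨x, mem_iUnion_of_mem a x.2⟩

theorem unionIncl_injective (a : A) : Function.Injective (unionIncl T a) := fun _ _ h =>
  Subtype.ext (congrArg (fun z : (⋃ a, T a : Set X) => (z : X)) h)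

theorem exists_unionIncl_eq (z : (⋃ a, T a : Set X)) : ∃ a x, unionIncl T a x = z := by
  obtain ⟨z, hz⟩ := z
  obtain ⟨a, ha⟩ := mem_iUnion.1 hz
  exact ⟨a, ⟨z, ha⟩, rfl⟩

/-- The indicator function, on the union of a family, of a subset of one member. -/
noncomputable def unionIndicator (a : A) (I : Set (T a)) : (⋃ a, T a : Set X) → ℝ :=
  indicator (unionIncl T a '' I) 1

variable {T}

theorem unionIndicator_eq_one_iff {a : A} {I : Set (T a)} {z : (⋃ a, T a : Set X)} :
    unionIndicator T a I z = 1 ↔ z ∈ unionIncl T a '' I := by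
  unfold unionIndicator
  by_cases h : z ∈ unionIncl T a '' I <;> simp [h]

theorem unionIndicator_incl_eq_one_iff {a : A} {I : Set (T a)} {x : T a} :
    unionIndicator T a I (unionIncl T a x) = 1 ↔ x ∈ I := by
  rw [unionIndicator_eq_one_iff, (unionIncl_injective T a).mem_set_image]

theorem unionIndicator_eq_zero_or_one (a : A) (I : Set (T a)) (z : (⋃ a, T a : Set X)) :
    unionIndicator T a I z = 0 ∨ unionIndicator T a I z = 1 := by
  unfold unionIndicator
  by_cases h : z ∈ unionIncl T a '' I <;> simp [h]

theorem unionIndicator_apply_eq_iff {a b : A} {I : Set (T a)} {J : Set (T b)}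
    {z : (⋃ a, T a : Set X)} :
    unionIndicator T a I z = unionIndicator T b J z ↔
      (unionIndicator T a I z = 1 ↔ unionIndicator T b J z = 1) := by
  rcases unionIndicator_eq_zero_or_one a I z with h | h <;>
  rcases unionIndicator_eq_zero_or_one b J z with h' | h' <;> simp [h, h']

theorem unionIncl_image_eq (a : A) (I : Set (T a)) :
    {x : (⋃ a, T a : Set X) | (x : X) ∈ (Subtype.val '' I : Set X)} = unionIncl T a '' I := by
  ext z
  constructor
  · rintro ⟨x, hx, hxz⟩
    exact ⟨x, hx, Subtype.ext hxz⟩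
  · rintro ⟨x, hx, rfl⟩
    exact ⟨x, hx, rfl⟩

variable [∀ a, PartialOrder (T a)]

theorem mem_intervalIndicators_iff {f : (⋃ a, T a : Set X) → ℝ} :
    f ∈ intervalIndicators T ↔ ∃ (a : A) (I : Set (T a)), IsTreeInterval I ∧
      f = unionIndicator T a I := by
  simp only [intervalIndicators, mem_ofPred_eq, unionIncl_image_eq, unionIndicator]

/-- Intervals of distinct members share at most one element. -/
def AlmostDisjointIntervals (T : A → Set X) [∀ a, PartialOrder (T a)] : Prop :=
  ∀ a b : A, a ≠ b → ∀ (I : Set (T a)) (J : Set (T b)), IsTreeInterval I → IsTreeInterval J →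
    ((Subtype.val '' I : Set X) ∩ (Subtype.val '' J : Set X)).Subsingleton

theorem AlmostDisjointIntervals.index_eq (h : AlmostDisjointIntervals T) {a b : A}
    {I : Set (T a)} {J : Set (T b)} (hI : IsTreeInterval I) (hJ : IsTreeInterval J)
    {x y : (⋃ a, T a : Set X)} (hxy : x ≠ y)
    (hxI : unionIndicator T a I x = 1) (hyI : unionIndicator T a I y = 1)
    (hxJ : unionIndicator T b J x = 1) (hyJ : unionIndicator T b J y = 1) : a = b := by
  by_contra hab
  rw [unionIndicator_eq_one_iff, ← unionIncl_image_eq] at hxI hyI hxJ hyJ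
  exact hxy (Subtype.ext (h a b hab I J hI hJ ⟨hxI, hxJ⟩ ⟨hyI, hyJ⟩))

/-! ### Compactness -/

theorem eq_zero_or_one_of_mem_closure {f : (⋃ a, T a : Set X) → ℝ}
    (hf : f ∈ closure (intervalIndicators T)) (z : (⋃ a, T a : Set X)) : f z = 0 ∨ f z = 1 := by
  have hcl : IsClosed {g : (⋃ a, T a : Set X) → ℝ | g z ∈ ({0, 1} : Set ℝ)} :=
    (Set.toFinite ({0, 1} : Set ℝ)).isClosed.preimage (continuous_apply z)
  refine closure_minimal (fun g hg => ?_) hcl hf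
  obtain ⟨a, I, -, rfl⟩ := mem_intervalIndicators_iff.1 hg
  exact unionIndicator_eq_zero_or_one a I z

theorem exists_interval_eqOn_finite {f : (⋃ a, T a : Set X) → ℝ}
    (hf : f ∈ closure (intervalIndicators T)) {s : Set (⋃ a, T a : Set X)} (hs : s.Finite) :
    ∃ (a : A) (I : Set (T a)), IsTreeInterval I ∧ EqOn (unionIndicator T a I) f s := by
  have hopen : IsOpen (s.pi fun z => Metric.ball (f z) 1) :=
    isOpen_set_pi hs fun _ _ => Metric.isOpen_ball
  obtain ⟨g, hg, hgΩ⟩ := mem_closure_iff.1 hf _ hopen fun z _ => Metric.mem_ball_self one_pos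
  obtain ⟨a, I, hI, rfl⟩ := mem_intervalIndicators_iff.1 hgΩ
  refine ⟨a, I, hI, fun z hz => ?_⟩
  have hd := hg z hz
  rw [Metric.mem_ball, Real.dist_eq] at hd
  rcases unionIndicator_eq_zero_or_one a I z with h | h <;>
  rcases eq_zero_or_one_of_mem_closure hf z with h' | h' <;> simp_all

theorem isClosed_intervalIndicators (hT : AlmostDisjointIntervals T) :
    IsClosed (intervalIndicators T) := by
  refine isClosed_of_closure_subset fun f hf => ?_
  rw [mem_intervalIndicators_iff]
  by_cases hS : {z | f z = 1}.Subsingleton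
  · obtain ⟨a, I, hI, hsub, hfI⟩ : ∃ (a : A) (I : Set (T a)), IsTreeInterval I ∧ I.Subsingleton ∧
        {z | f z = 1} = unionIncl T a '' I := by
      rcases hS.eq_empty_or_singleton with h | ⟨z, h⟩
      -- Only some index is needed; an approximant on the empty set supplies it.
      · obtain ⟨a, -, -⟩ := exists_interval_eqOn_finite hf finite_empty
        exact ⟨a, ∅, isTreeInterval_of_subsingleton subsingleton_empty, subsingleton_empty,
          by simpa using h⟩
      · obtain ⟨a, x, rfl⟩ := exists_unionIncl_eq T z
        exact ⟨a, {x}, isTreeInterval_of_subsingleton subsingleton_singleton,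
          subsingleton_singleton, by simpa using h⟩
    refine ⟨a, I, hI, funext fun z => ?_⟩
    have hz : f z = 1 ↔ unionIndicator T a I z = 1 := by
      rw [unionIndicator_eq_one_iff, ← hfI, mem_ofPred_eq]
    rcases unionIndicator_eq_zero_or_one a I z with h | h <;>
    rcases eq_zero_or_one_of_mem_closure hf z with h' | h' <;> simp_all
  · obtain ⟨x, hx, y, hy, hxy⟩ := Set.not_subsingleton_iff.1 hS
    have hfin : ({x, y} : Set (⋃ a, T a : Set X)).Finite := Set.toFinite _
    obtain ⟨a, I₀, hI₀, hI₀f⟩ := exists_interval_eqOn_finite hf hfin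
    have approx : ∀ s : Set (⋃ a, T a : Set X), s.Finite →
        ∃ I : Set (T a), IsTreeInterval I ∧ EqOn (unionIndicator T a I) f s := by
      intro s hs
      -- Adjoining `x` and `y` to `s` forces the approximant into the tree `T a`.
      obtain ⟨b, I, hI, hIf⟩ := exists_interval_eqOn_finite hf (hs.union hfin)
      obtain rfl : a = b := hT.index_eq hI₀ hI hxy
        ((hI₀f (by simp)).trans hx) ((hI₀f (by simp)).trans hy)
        ((hIf (by simp)).trans hx) ((hIf (by simp)).trans hy)
      exact ⟨I, hI, hIf.mono subset_union_left⟩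
    have approx' : ∀ s : Set (T a), s.Finite →
        ∃ I : Set (T a), IsTreeInterval I ∧ ∀ t ∈ s, t ∈ I ↔ f (unionIncl T a t) = 1 := by
      intro s hs
      obtain ⟨I, hI, hIf⟩ := approx _ (hs.image (unionIncl T a))
      refine ⟨I, hI, fun t ht => ?_⟩
      rw [← hIf (mem_image_of_mem _ ht), unionIndicator_incl_eq_one_iff]
    refine ⟨a, {t | f (unionIncl T a t) = 1}, ⟨?_, ?_⟩, funext fun z => ?_⟩
    · intro r hr t ht hne
      obtain ⟨I, hI, hIf⟩ := approx' {r, t} (Set.toFinite _)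
      exact hI.1 ((hIf r (by simp)).2 hr) ((hIf t (by simp)).2 ht) hne
    · intro r hr t ht s hrs hst
      obtain ⟨I, hI, hIf⟩ := approx' {r, t, s} (Set.toFinite _)
      exact (hIf s (by simp)).1
        (hI.2 r ((hIf r (by simp)).2 hr) t ((hIf t (by simp)).2 ht) s hrs hst)
    · obtain ⟨I, -, hIf⟩ := approx {z} (finite_singleton z)
      rw [← hIf rfl, unionIndicator_apply_eq_iff, unionIndicator_eq_one_iff (I := {t | f (unionIncl T a t) = 1})]
      constructor
      · intro h
        obtain ⟨t, ht, rfl⟩ := unionIndicator_eq_one_iff.1 h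
        exact ⟨t, (hIf rfl).symm.trans h, rfl⟩
      · rintro ⟨t, ht, rfl⟩
        exact (hIf rfl).trans ht

theorem isCompact_intervalIndicators (hT : AlmostDisjointIntervals T) :
    IsCompact (intervalIndicators T) := by
  refine IsCompact.of_isClosed_subset
    (isCompact_univ_pi fun _ => (Set.toFinite ({0, 1} : Set ℝ)).isCompact)
    (isClosed_intervalIndicators hT) fun f hf z _ => ?_
  exact eq_zero_or_one_of_mem_closure (subset_closure hf) z

theorem intervalIndicators_ext {f g : intervalIndicators T}
    (h : {z | f.1 z = 1} = {z | g.1 z = 1}) : f = g := by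
  refine Subtype.ext (funext fun z => ?_)
  have hz : f.1 z = 1 ↔ g.1 z = 1 := Set.ext_iff.1 h z
  rcases eq_zero_or_one_of_mem_closure (subset_closure f.2) z with h | h <;>
  rcases eq_zero_or_one_of_mem_closure (subset_closure g.2) z with h' | h' <;> simp_all

/-- Taking the value `1` at finitely many prescribed points is an open condition. -/
theorem isOpen_setOf_eq_one_on {s : Set (⋃ a, T a : Set X)} (hs : s.Finite) :
    IsOpen {g : intervalIndicators T | ∀ z ∈ s, g.1 z = 1} := by
  have : {g : intervalIndicators T | ∀ z ∈ s, g.1 z = 1} =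
      Subtype.val ⁻¹' (s.pi fun _ => Ioi (0 : ℝ)) := by
    ext g
    refine forall₂_congr fun z _ => ?_
    rw [mem_Ioi]
    rcases eq_zero_or_one_of_mem_closure (subset_closure g.2) z with h | h <;> simp [h]
  rw [this]
  exact (isOpen_set_pi hs fun _ _ => isOpen_Ioi).preimage continuous_subtype_val

theorem exists_finite_eqOn_subset {U : Set (intervalIndicators T)} (hU : IsOpen U)
    {f : intervalIndicators T} (hf : f ∈ U) :
    ∃ s : Set (⋃ a, T a : Set X), s.Finite ∧
      ∀ g : intervalIndicators T, EqOn g.1 f.1 s → g ∈ U := by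
  obtain ⟨V, hV, rfl⟩ := isOpen_induced_iff.1 hU
  obtain ⟨s, u, hu, hsub⟩ := isOpen_pi_iff.1 hV f.1 hf
  refine ⟨s, s.finite_toSet, fun g hg => hsub fun z hz => ?_⟩
  rw [hg hz]
  exact (hu z hz).2

/-! ### The network of level cells -/

/-- The indicators of the intervals of `T a` with the same elements as `I` at the levels in `H`. -/
def levelCell (lev : ∀ a, T a → ℕ) (a : A) (I : Set (T a)) (H : Finset ℕ) :
    Set (intervalIndicators T) :=
  {g | ∃ J : Set (T a), IsTreeInterval J ∧ g.1 = unionIndicator T a J ∧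
    ∀ x, lev a x ∈ H → (x ∈ J ↔ x ∈ I)}

/-- The level cells of intervals with at least two elements at the levels in `H`, the levels
in `H` which they occupy being exactly those in `F`. -/
def levelCellFamily (lev : ∀ a, T a → ℕ) (F H : Finset ℕ) : Set (Set (intervalIndicators T)) :=
  {E | ∃ (a : A) (I : Set (T a)), IsTreeInterval I ∧
    (∃ x ∈ I, ∃ y ∈ I, x ≠ y ∧ lev a x ∈ H ∧ lev a y ∈ H) ∧
    (lev a '' I) ∩ H = F ∧ E = levelCell lev a I H}

theorem isIsolatedFamily_levelCellFamily (hT : AlmostDisjointIntervals T) {lev : ∀ a, T a → ℕ}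
    (hlev : ∀ a, ∀ C : Set (T a), IsChain (· ≤ ·) C → InjOn (lev a) C) (F H : Finset ℕ) :
    IsIsolatedFamily (levelCellFamily lev F H) := by
  refine isIsolatedFamily_of_open_expansion ?_
  rintro _ ⟨a, I, hI, ⟨x, hx, y, hy, hxy, hxH, hyH⟩, hIF, rfl⟩
  have hfin : {t ∈ I | lev a t ∈ H}.Finite :=
    Set.Finite.of_finite_image (H.finite_toSet.subset (by rintro _ ⟨t, ht, rfl⟩; exact ht.2))
      ((hlev a I hI.1).mono (sep_subset _ _))
  refine ⟨{g | ∀ z ∈ unionIncl T a '' {t ∈ I | lev a t ∈ H}, g.1 z = 1},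
    isOpen_setOf_eq_one_on (hfin.image _), ?_, ?_⟩
  · rintro g ⟨J, -, hgJ, hJI⟩ _ ⟨t, ⟨htI, htH⟩, rfl⟩
    rw [hgJ, unionIndicator_incl_eq_one_iff]
    exact (hJI t htH).2 htI
  · rintro _ ⟨b, I', hI', -, hIF', rfl⟩ ⟨g, ⟨J, hJ, hgJ, hJI'⟩, hg⟩
    have hone : ∀ t ∈ I, lev a t ∈ H → unionIndicator T b J (unionIncl T a t) = 1 :=
      fun t ht htH => hgJ ▸ hg _ ⟨t, ⟨ht, htH⟩, rfl⟩
    obtain rfl : a = b := hT.index_eq hI hJ ((unionIncl_injective T a).ne hxy)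
      (unionIndicator_incl_eq_one_iff.2 hx) (unionIndicator_incl_eq_one_iff.2 hy)
      (hone x hx hxH) (hone y hy hyH)
    have hsub : ∀ t ∈ I, lev a t ∈ H → t ∈ I' := fun t ht htH =>
      (hJI' t htH).1 (unionIndicator_incl_eq_one_iff.1 (hone t ht htH))
    have hagree : ∀ t, lev a t ∈ H → (t ∈ I' ↔ t ∈ I) := by
      refine fun t htH => ⟨fun ht => ?_, fun ht => hsub t ht htH⟩
      -- Both intervals occupy the levels `F`, so `I` has a point `r` at the level of `t`; it lies
      -- in the chain `I'` too, whence `r = t`.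
      have hmem : lev a t ∈ (lev a '' I) ∩ H := hIF.symm ▸ hIF' ▸ ⟨⟨t, ht, rfl⟩, htH⟩
      obtain ⟨r, hr, hrt⟩ := hmem.1
      rwa [← hlev a I' hI'.1 (hsub r hr (hrt ▸ htH)) ht hrt]
    ext g'
    exact exists_congr fun J' => and_congr_right fun _ => and_congr_right fun _ =>
      forall₂_congr fun t htH => iff_congr Iff.rfl (hagree t htH)

/-- Among one-point supports, the open condition of value `1` at `z` leaves only `{z}`. -/
theorem isIsolatedFamily_singletons_of_supp_subsingleton :
    IsIsolatedFamily {E : Set (intervalIndicators T) |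
      ∃ g z, {w | g.1 w = 1} = {z} ∧ E = {g}} := by
  refine isIsolatedFamily_of_open_expansion ?_
  rintro _ ⟨g, z, hg, rfl⟩
  refine ⟨_, isOpen_setOf_eq_one_on (finite_singleton z), ?_, ?_⟩
  · rintro _ rfl _ rfl
    exact hg.symm.subset rfl
  · rintro _ ⟨g', z', hg', rfl⟩ ⟨w, hw, hU⟩
    rw [mem_singleton_iff.1 hw] at hU
    obtain rfl : z = z' := hg'.subset (hU z rfl)
    rw [singleton_eq_singleton_iff]
    exact intervalIndicators_ext (hg'.trans hg.symm)

theorem isIsolatedFamily_singleton {Z : Type*} [TopologicalSpace Z] (E : Set Z) :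
    IsIsolatedFamily {E} :=
  isIsolatedFamily_of_open_expansion fun _ hE =>
    ⟨univ, isOpen_univ, subset_univ _, fun _ hE' _ => hE'.trans hE.symm⟩

/-- The level cells form a network at the indicators of intervals with at least two elements. -/
theorem exists_levelCell_subset {lev : ∀ a, T a → ℕ} {U : Set (intervalIndicators T)}
    (hU : IsOpen U) {f : intervalIndicators T} (hf : f ∈ U) (hS : ¬{z | f.1 z = 1}.Subsingleton) :
    ∃ F H, ∃ E ∈ levelCellFamily lev F H, f ∈ E ∧ E ⊆ U := by
  classical
  obtain ⟨s, hs, hsU⟩ := exists_finite_eqOn_subset hU hf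
  obtain ⟨a, I, hI, hfI⟩ := mem_intervalIndicators_iff.1 f.2
  obtain ⟨x, hx, y, hy, hxy⟩ := Set.not_subsingleton_iff.1 hS
  rw [mem_ofPred_eq, hfI, unionIndicator_eq_one_iff] at hx hy
  obtain ⟨x, hx, rfl⟩ := hx
  obtain ⟨y, hy, rfl⟩ := hy
  -- Including the levels of `x` and `y` gives the cell the two points that fix its tree.
  have hfin : (lev a '' (unionIncl T a ⁻¹' s ∪ {x, y})).Finite :=
    ((hs.preimage (unionIncl_injective T a).injOn).union (Set.toFinite _)).image _
  have hH : ∀ t, t ∈ unionIncl T a ⁻¹' s ∪ {x, y} → lev a t ∈ hfin.toFinset := fun t ht =>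
    hfin.mem_toFinset.2 (mem_image_of_mem _ ht)
  refine ⟨hfin.toFinset.filter (· ∈ lev a '' I), hfin.toFinset, _, ⟨a, I, hI,
    ⟨x, hx, y, hy, ne_of_apply_ne _ hxy, hH x (by simp), hH y (by simp)⟩, ?_, rfl⟩,
    ⟨I, hI, hfI, fun _ _ => Iff.rfl⟩, ?_⟩
  · ext n
    simp only [mem_inter_iff, Finset.mem_coe, Finset.mem_filter, and_comm]
  · rintro g ⟨J, -, hgJ, hJI⟩
    refine hsU g fun z hz => ?_
    rw [hgJ, hfI, unionIndicator_apply_eq_iff, unionIndicator_eq_one_iff,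
      unionIndicator_eq_one_iff]
    constructor <;> rintro ⟨t, ht, rfl⟩
    · exact ⟨t, (hJI t (hH t (Or.inl hz))).1 ht, rfl⟩
    · exact ⟨t, (hJI t (hH t (Or.inl hz))).2 ht, rfl⟩

theorem exists_isolated_network (hT : AlmostDisjointIntervals T)
    (hspecial : ∀ a, IsSpecialOrder (T a)) :
    ∃ N : ℕ → Set (Set (intervalIndicators T)),
      (∀ n, IsIsolatedFamily (N n)) ∧ IsNetwork (⋃ n, N n) := by
  choose lev hlev using fun a => (hspecial a).exists_level
  -- `true` indexes the empty support, `false` the one-point supports.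
  refine exists_nat_network_of_countable (ι := Bool ⊕ Finset ℕ × Finset ℕ)
    (Sum.elim (fun i => bif i then {{g | {z | g.1 z = 1} = ∅}}
      else {E | ∃ g z, {w | g.1 w = 1} = {z} ∧ E = {g}})
      (fun p => levelCellFamily lev p.1 p.2)) ?_ ?_
  · rintro ((_ | _) | ⟨F, H⟩)
    · exact isIsolatedFamily_singletons_of_supp_subsingleton
    · exact isIsolatedFamily_singleton _
    · exact isIsolatedFamily_levelCellFamily hT hlev F H
  · intro f U hU hf
    by_cases hS : {z | f.1 z = 1}.Subsingleton
    · rcases hS.eq_empty_or_singleton with h | ⟨z, h⟩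
      · refine ⟨_, mem_iUnion.2 ⟨Sum.inl true, rfl⟩, h, fun g hg => ?_⟩
        rwa [intervalIndicators_ext (f := g) (g := f) (Eq.trans hg h.symm)]
      · exact ⟨{f}, mem_iUnion.2 ⟨Sum.inl false, f, z, h, rfl⟩, rfl, singleton_subset_iff.2 hf⟩
    · obtain ⟨F, H, E, hE, hfE, hEU⟩ := exists_levelCell_subset (lev := lev) hU hf hS
      exact ⟨E, mem_iUnion.2 ⟨Sum.inr (F, H), hE⟩, hfE, hEU⟩

end Union

theorem mainTheorem6 {X A : Type*} (T : A → Set X) [∀ a, PartialOrder (T a)]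
    (hT : ∀ a, IsPseudotree (T a))
    (hspecial : ∀ a, IsSpecialOrder (T a))
    (hinter : ∀ a b : A, a ≠ b → ∀ (I : Set (T a)) (J : Set (T b)),
      IsTreeInterval I → IsTreeInterval J →
        ((Subtype.val '' I : Set X) ∩ (Subtype.val '' J : Set X)).Subsingleton) :
    IsCompact (intervalIndicators T) ∧ IsDescriptive (intervalIndicators T) := by
  have hc := isCompact_intervalIndicators (T := T) hinter
  exact ⟨hc, inferInstance, isCompact_iff_compactSpace.1 hc,
    exists_isolated_network hinter hspecial⟩
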